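/- Let $\mathbb H$ be the quaternions, let $\mathbb S=\{K\in\mathbb H: K^2=-1\}$, and let $\mathbb C_K=\mathbb R+\mathbb R K$ for $K\in\mathbb S$. Let $n\ge 0$ and let $\mathbb H[q_1,\dots,q_n]$ be the ring of slice regular polynomials $P(q_1,\dots,q_n)=\sum_{\ell}q_1^{\ell_1}\cdots q_n^{\ell_n}a_\ell$ with $a_\ell\in\mathbb H$, with the biadditive slice product $*$ determined by $$(q_1^{m_1}\cdots q_n^{m_n}a)*(q_1^{l_1}\cdots q_n^{l_n}b)=q_1^{m_1+l_1}\cdots q_n^{m_n+l_n}ab .$$ For $P=\sum_\ell q_1^{\ell_1}\cdots q_n^{\ell_n}a_\ell$ put $P^c=\sum_\ell q_1^{\ell_1}\cdots q_n^{\ell_n}\overline{a_\ell}$ and $P^s=P*P^c$. For a right ideal $I$ of $\mathbb H[q_1,\dots,q_n]$: * $I$ is *completely prime* if, for all polynomials $P,Q$, the conditions $P*Q\in I$ and $P*I\subseteq I$ imply $P\in I$ or $Q\in I$. * $I$ is *radical* if it equals the intersection $\sqrt I$ of all completely prime right ideals containing $I$. * $I$ is *quasi prime* if, for all polynomials $P,Q$,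 the condition $P*Q\in I$ implies $P\in I$ or $Q^s\in I$. * $\mathcal V_c(I)$ is the set of all $\mathbf a\in\bigcup_{K\in\mathbb S}\mathbb C_K^n\subseteq\mathbb H^n$ such that $P(\mathbf a)=0$ for every $P\in I$. * $\mathcal V_c(I)$ is *reducible* if there are proper nonzero right ideals $I_1,I_2$ with $\mathcal V_c(I)=\mathcal V_c(I_1)\cup\mathcal V_c(I_2)$, $\mathcal V_c(I_1)\not\subseteq\mathcal V_c(I_2)$ and $\mathcal V_c(I_2)\not\subseteq\mathcal V_c(I_1)$; otherwise it is *irreducible*. **Theorem.** Let $I$ be a radical right ideal of $\mathbb H[q_1,\dots,q_n]$. Then $I$ is quasi prime if and only if $\mathcal V_c(I)$ is irreducible. -/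

import Mathlib

open scoped Quaternion

noncomputable section

/-- The ring `ℍ[q₁, …, qₙ]` of slice regular polynomials: formal sums of monomials
`q₁ ^ ℓ₁ ⋯ qₙ ^ ℓₙ a`, with coefficient `a` on the right. The convolution product of the monoid
algebra is the slice product, `q ^ m a * q ^ l b = q ^ (m + l) a b`. A polynomial function determines
its coefficients (restrict it to `ℝⁿ`), so these are the same as polynomial functions. -/
abbrev SlicePoly (n : ℕ) : Type := AddMonoidAlgebra ℍ[ℝ] (Fin n →₀ ℕ)

/-- Right ideals: additive subgroups stable under multiplication on the right. -/
abbrev SliceRightIdeal (n : ℕ) : Type := Submodule (SlicePoly n)ᵐᵒᵖ (SlicePoly n)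

namespace SlicePoly

variable {n : ℕ}

/-- The value `∑ a₁ ^ ℓ₁ ⋯ aₙ ^ ℓₙ c_ℓ`, the powers being multiplied in this order. -/
def eval (a : Fin n → ℍ[ℝ]) (P : SlicePoly n) : ℍ[ℝ] :=
  P.coeff.sum fun l c => (List.ofFn fun i => a i ^ l i).prod * c

/-- The regular conjugate `P ^ c`: every coefficient is replaced by its quaternionic conjugate. -/
def regConj (P : SlicePoly n) : SlicePoly n :=
  AddMonoidAlgebra.ofCoeff (P.coeff.mapRange star (star_zero _))

/-- The symmetrization `P ^ s = P * P ^ c`. -/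
def symmetrization (P : SlicePoly n) : SlicePoly n :=
  P * regConj P

end SlicePoly

/-- The slice `ℂ_K = ℝ + ℝ K`. -/
def quaternionSlice (K : ℍ[ℝ]) : Set ℍ[ℝ] :=
  {q | ∃ x y : ℝ, q = (x : ℍ[ℝ]) + (y : ℍ[ℝ]) * K}

namespace SliceRightIdeal

variable {n : ℕ}

/-- `I` is completely prime: `P * Q ∈ I` and `P * I ⊆ I` imply `P ∈ I` or `Q ∈ I`. The unit ideal
is not excluded; excluding it would not change the radical. -/
def IsCompletelyPrime (I : SliceRightIdeal n) : Prop :=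
  ∀ P Q : SlicePoly n, P * Q ∈ I → (∀ R ∈ I, P * R ∈ I) → P ∈ I ∨ Q ∈ I

/-- The right radical: the intersection of all completely prime right ideals containing `I`. -/
def radical (I : SliceRightIdeal n) : SliceRightIdeal n :=
  sInf {J | I ≤ J ∧ IsCompletelyPrime J}

def IsRadical (I : SliceRightIdeal n) : Prop :=
  radical I = I

/-- `I` is quasi prime: `P * Q ∈ I` implies `P ∈ I` or `Q ^ s ∈ I`. -/
def IsQuasiPrime (I : SliceRightIdeal n) : Prop :=
  ∀ P Q : SlicePoly n, P * Q ∈ I → P ∈ I ∨ Q.symmetrization ∈ I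

/-- `𝒱(I)`: the common zeros in `ℍⁿ` of the elements of `I`. -/
def zeroLocus (I : SliceRightIdeal n) : Set (Fin n → ℍ[ℝ]) :=
  {a | ∀ P ∈ I, SlicePoly.eval a P = 0}

/-- `𝒱_c(I)`: the common zeros of `I` lying in `ℂ_K ⁿ` for some imaginary unit `K`. -/
def sliceZeroLocus (I : SliceRightIdeal n) : Set (Fin n → ℍ[ℝ]) :=
  zeroLocus I ∩ {a | ∃ K : ℍ[ℝ], K * K = -1 ∧ ∀ i, a i ∈ quaternionSlice K}

end SliceRightIdeal

/-- A set `V ⊆ ℍⁿ` is reducible when it is `𝒱_c(I₁) ∪ 𝒱_c(I₂)` for proper nonzero right ideals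
`I₁`, `I₂` such that neither of the two sets contains the other. -/
def IsSliceReducible {n : ℕ} (V : Set (Fin n → ℍ[ℝ])) : Prop :=
  ∃ I₁ I₂ : SliceRightIdeal n,
    I₁ ≠ ⊥ ∧ I₁ ≠ ⊤ ∧ I₂ ≠ ⊥ ∧ I₂ ≠ ⊤ ∧
    ¬ I₁.sliceZeroLocus ⊆ I₂.sliceZeroLocus ∧
    ¬ I₂.sliceZeroLocus ⊆ I₁.sliceZeroLocus ∧
    V = I₁.sliceZeroLocus ∪ I₂.sliceZeroLocus

def IsSliceIrreducible {n : ℕ} (V : Set (Fin n → ℍ[ℝ])) : Prop :=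
  ¬ IsSliceReducible V

end

/-! A polynomial `P` has a value `w = u + √-1 v` in `ℍ ⊗ ℂ` at each `z ∈ ℂⁿ`, and its values on the
sphere over `z`, indexed by the imaginary units `K`, are `u + K v`. If two of these vanish, then `w
= 0` and `P` vanishes on the whole sphere. Since `P ^ s` takes the scalar value `normSq w`, it
vanishes at `z` exactly when `P` has a zero on the sphere.

The main tool is the Nullstellensatz `IsRadical.mem_of_forall_ofPoint`. Real polynomials are
central, so a completely prime `J` meets them in a prime ideal `p`, and the quotient by `J` is a
finite torsion-free module over the domain of real polynomials modulo `p`. Linear functionals and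
the complex Nullstellensatz then yield a `z` at which the value of a given `P ∉ J` is not attained
on `J`; linear algebra in `ℍ ⊗ ℂ` turns this into a zero of `J` where `P` does not vanish.

If `P * Q ∈ I`, the zeros of `I` are those of `I + (P)` together with those of `I + (Q ^ s)`;
irreducibility makes one set contain the other, and the Nullstellensatz puts `P` or `Q ^ s` in `I`.
Conversely, let the zeros of a quasi prime `I` split between `I₁` and `I₂`, neither zero set
containing the other. Every sphere meeting the zeros of `I` meets those of `I₁`, so a zero of `I`
missed by `I₁` lies on a sphere consisting of zeros of `I₂`. Quasi primality then forces `I₂` to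
vanish at every zero of `I₁`, a contradiction. -/

open scoped Quaternion

noncomputable section

/-! ### Complexified quaternions, their norm and their specializations -/

namespace Quaternion

/-- The inclusion `ℍ → ℍ ⊗ ℂ`, as a function. -/
def toComplexified (q : ℍ[ℝ]) : ℍ[ℂ] := ⟨q.re, q.imI, q.imJ, q.imK⟩

/-- The real part of a complexified quaternion `u + √-1 v`. -/
def realPart (w : ℍ[ℂ]) : ℍ[ℝ] := ⟨w.re.re, w.imI.re, w.imJ.re, w.imK.re⟩

/-- The imaginary part of a complexified quaternion `u + √-1 v`. -/
def imagPart (w : ℍ[ℂ]) : ℍ[ℝ] := ⟨w.re.im, w.imI.im, w.imJ.im, w.imK.im⟩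

section components

variable (q : ℍ[ℝ]) (w : ℍ[ℂ])

@[simp] theorem re_toComplexified : (toComplexified q).re = q.re := rfl
@[simp] theorem imI_toComplexified : (toComplexified q).imI = q.imI := rfl
@[simp] theorem imJ_toComplexified : (toComplexified q).imJ = q.imJ := rfl
@[simp] theorem imK_toComplexified : (toComplexified q).imK = q.imK := rfl
@[simp] theorem re_realPart : (realPart w).re = w.re.re := rfl
@[simp] theorem imI_realPart : (realPart w).imI = w.imI.re := rfl
@[simp] theorem imJ_realPart : (realPart w).imJ = w.imJ.re := rfl
@[simp] theorem imK_realPart : (realPart w).imK = w.imK.re := rfl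
@[simp] theorem re_imagPart : (imagPart w).re = w.re.im := rfl
@[simp] theorem imI_imagPart : (imagPart w).imI = w.imI.im := rfl
@[simp] theorem imJ_imagPart : (imagPart w).imJ = w.imJ.im := rfl
@[simp] theorem imK_imagPart : (imagPart w).imK = w.imK.im := rfl

end components

/-- The inclusion `ℍ → ℍ ⊗ ℂ`. -/
def complexify : ℍ[ℝ] →+* ℍ[ℂ] where
  toFun := toComplexified
  map_one' := by ext <;> simp
  map_zero' := by ext <;> simp
  map_add' a b := by ext <;> simp
  map_mul' a b := by ext <;> simp

theorem complexify_apply (q : ℍ[ℝ]) : complexify q = toComplexified q := rfl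

theorem complexified_ext {w w' : ℍ[ℂ]} (hr : realPart w = realPart w')
    (hi : imagPart w = imagPart w') : w = w' := by
  rw [Quaternion.ext_iff] at hr hi ⊢
  simp only [Complex.ext_iff]
  exact ⟨⟨hr.1, hi.1⟩, ⟨hr.2.1, hi.2.1⟩, ⟨hr.2.2.1, hi.2.2.1⟩, ⟨hr.2.2.2, hi.2.2.2⟩⟩

@[simp] theorem realPart_zero : realPart 0 = 0 := by ext <;> simp

@[simp] theorem imagPart_zero : imagPart 0 = 0 := by ext <;> simp

theorem imagPart_sub (w w' : ℍ[ℂ]) : imagPart (w - w') = imagPart w - imagPart w' := by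
  ext <;> simp

theorem realPart_mul_complexify (w : ℍ[ℂ]) (q : ℍ[ℝ]) :
    realPart (w * complexify q) = realPart w * q := by
  ext <;> simp [complexify_apply]

theorem imagPart_mul_complexify (w : ℍ[ℂ]) (q : ℍ[ℝ]) :
    imagPart (w * complexify q) = imagPart w * q := by
  ext <;> simp [complexify_apply]

/-- The specialization `u + √-1 v ↦ u + K v`. -/
def specialize (K : ℍ[ℝ]) : ℍ[ℂ] →+ ℍ[ℝ] where
  toFun w := realPart w + K * imagPart w
  map_zero' := by simp
  map_add' a b := by ext <;> simp <;> ring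

theorem specialize_apply (K : ℍ[ℝ]) (w : ℍ[ℂ]) :
    specialize K w = realPart w + K * imagPart w := rfl

theorem specialize_complexify (K q : ℍ[ℝ]) : specialize K (complexify q) = q := by
  have h : imagPart (complexify q) = 0 := by ext <;> simp [complexify_apply]
  rw [specialize_apply, h]
  ext <;> simp [complexify_apply]

theorem specialize_mul_complexify (K : ℍ[ℝ]) (w : ℍ[ℂ]) (q : ℍ[ℝ]) :
    specialize K (w * complexify q) = specialize K w * q := by
  simp only [specialize_apply, realPart_mul_complexify, imagPart_mul_complexify]
  noncomm_ring

/-- Specialization is not multiplicative, but it is linear for left multiplication by scalars, `ℂ`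
acting on `ℍ` through `ℂ_K`. -/
theorem specialize_coe_mul {K : ℍ[ℝ]} (hK : K * K = -1) (t : ℂ) (w : ℍ[ℂ]) :
    specialize K ((t : ℍ[ℂ]) * w) = Complex.lift ⟨K, hK⟩ t * specialize K w := by
  have hr : realPart ((t : ℍ[ℂ]) * w) = t.re • realPart w - t.im • imagPart w := by
    ext <;> simp
  have hi : imagPart ((t : ℍ[ℂ]) * w) = t.re • imagPart w + t.im • realPart w := by
    ext <;> simp
  have h : K * (K * imagPart w) = -imagPart w := by rw [← mul_assoc, hK]; simp
  simp only [specialize_apply, hr, hi, Complex.lift_apply, Complex.liftAux_apply, add_mul, mul_add,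
    smul_mul_assoc, mul_smul_comm, h, Algebra.algebraMap_eq_smul_one, one_mul]
  module

theorem eq_zero_of_specialize_eq_zero {K K' : ℍ[ℝ]} (hne : K ≠ K') {w : ℍ[ℂ]}
    (h : specialize K w = 0) (h' : specialize K' w = 0) : w = 0 := by
  rw [specialize_apply] at h h'
  have hv : (K - K') * imagPart w = 0 := by
    rw [sub_mul, sub_eq_zero]; exact add_left_cancel (h.trans h'.symm)
  have hv : imagPart w = 0 := (mul_eq_zero.1 hv).resolve_left (sub_ne_zero.2 hne)
  have hu : realPart w = 0 := by simpa [hv] using h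
  exact complexified_ext (hu.trans realPart_zero.symm) (hv.trans imagPart_zero.symm)

theorem re_normSq (w : ℍ[ℂ]) :
    (normSq w).re = normSq (realPart w) - normSq (imagPart w) := by
  simp [normSq_def', pow_two]; ring

theorem im_normSq (w : ℍ[ℂ]) :
    (normSq w).im = 2 * (realPart w * star (imagPart w)).re := by
  simp [normSq_def', pow_two]; ring

theorem eq_zero_of_imagPart_eq_zero {w : ℍ[ℂ]} (h : imagPart w = 0) (hw : normSq w = 0) :
    w = 0 := by
  have h1 := re_normSq w
  rw [hw, h] at h1
  have hr : realPart w = 0 := by simpa using h1.symm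
  exact complexified_ext (hr.trans realPart_zero.symm) (h.trans imagPart_zero.symm)

theorem exists_mul_self_eq_neg_one : ∃ K : ℍ[ℝ], K * K = -1 := by
  obtain ⟨K, h1, h2, h3, h4⟩ :
      ∃ K : ℍ[ℝ], K.re = 0 ∧ K.imI = 1 ∧ K.imJ = 0 ∧ K.imK = 0 := ⟨⟨0, 1, 0, 0⟩, rfl, rfl, rfl, rfl⟩
  exact ⟨K, by ext <;> simp [h1, h2, h3, h4]⟩

theorem exists_specialize_eq_zero {w : ℍ[ℂ]} (hw : normSq w = 0) :
    ∃ K : ℍ[ℝ], K * K = -1 ∧ specialize K w = 0 := by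
  by_cases hv : imagPart w = 0
  · obtain ⟨K, hK⟩ := exists_mul_self_eq_neg_one
    exact ⟨K, hK, by rw [eq_zero_of_imagPart_eq_zero hv hw, map_zero]⟩
  have h1 := re_normSq w
  have h2 := im_normSq w
  rw [hw] at h1 h2
  have hn : normSq (imagPart w) ≠ 0 := normSq_ne_zero.2 hv
  have h1 : normSq (realPart w) = normSq (imagPart w) := sub_eq_zero.1 h1.symm
  have h2 : (realPart w * star (imagPart w)).re = 0 := by simpa using h2.symm
  -- This `K` solves `u + K v = 0`. The real and imaginary parts of `normSq w = 0` say that `u` and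
  -- `v` have equal norm and are orthogonal, so `K` is an imaginary unit.
  refine ⟨-(realPart w * (imagPart w)⁻¹), ?_, ?_⟩
  · rw [← pow_two, sq_eq_neg_normSq.2]
    · simp [h1, hn]
    · rw [Quaternion.inv_def, mul_smul_comm]
      rw [re_neg, re_smul, h2]; simp
  · rw [specialize_apply, neg_mul, inv_mul_cancel_right₀ hv, add_neg_cancel]

/-- The zeros of a specialization form a one-dimensional right `ℍ`-vector space. -/
theorem exists_eq_mul_complexify {K : ℍ[ℝ]} {w₀ w : ℍ[ℂ]} (hw₀ : w₀ ≠ 0)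
    (h₀ : specialize K w₀ = 0) (h : specialize K w = 0) : ∃ q, w = w₀ * complexify q := by
  have hv : imagPart w₀ ≠ 0 := fun hv => hw₀ <| complexified_ext
    (by simpa [specialize_apply, hv] using h₀) (hv.trans imagPart_zero.symm)
  refine ⟨(imagPart w₀)⁻¹ * imagPart w, complexified_ext ?_ ?_⟩
  · rw [specialize_apply, add_eq_zero_iff_eq_neg] at h₀ h
    rw [realPart_mul_complexify, h₀, h, neg_mul, mul_assoc, mul_inv_cancel_left₀ hv]
  · rw [imagPart_mul_complexify, mul_inv_cancel_left₀ hv]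

/-- A right `ℍ`-subspace of `ℍ ⊗ ℂ` all of whose elements have norm zero is annihilated by a
specialization. -/
theorem exists_specialize_eq_zero_of_normSq {W : Set ℍ[ℂ]}
    (hsub : ∀ w ∈ W, ∀ w' ∈ W, w - w' ∈ W) (hmul : ∀ w ∈ W, ∀ q, w * complexify q ∈ W)
    (hW : ∀ w ∈ W, normSq w = 0) :
    ∃ K : ℍ[ℝ], K * K = -1 ∧ ∀ w ∈ W, specialize K w = 0 := by
  by_cases h : ∃ w₀ ∈ W, w₀ ≠ 0
  · obtain ⟨w₀, hw₀, hne⟩ := h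
    have hv : imagPart w₀ ≠ 0 := fun hv => hne (eq_zero_of_imagPart_eq_zero hv (hW w₀ hw₀))
    obtain ⟨K, hK, h₀⟩ := exists_specialize_eq_zero (hW w₀ hw₀)
    refine ⟨K, hK, fun w hw => ?_⟩
    -- Subtracting a multiple of `w₀` cancels the imaginary part; a null element with no imaginary
    -- part is zero.
    have hmem := hsub _ hw _ (hmul w₀ hw₀ ((imagPart w₀)⁻¹ * imagPart w))
    have hz := eq_zero_of_imagPart_eq_zero
      (by rw [imagPart_sub, imagPart_mul_complexify, mul_inv_cancel_left₀ hv, sub_self])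
      (hW _ hmem)
    rw [sub_eq_zero.1 hz, specialize_mul_complexify, h₀, zero_mul]
  · push Not at h
    obtain ⟨K, hK⟩ := exists_mul_self_eq_neg_one
    exact ⟨K, hK, fun w hw => by rw [h w hw, map_zero]⟩

end Quaternion

/-! ### Components of a polynomial and evaluation at complex points -/

namespace Quaternion

/-- The basis `1, i, j, k` of the quaternions. -/
def stdBasis (R : Type*) [CommRing R] : Module.Basis (Fin 4) R ℍ[R] :=
  QuaternionAlgebra.basisOneIJK (-1 : R) 0 (-1)

theorem stdBasis_repr {R : Type*} [CommRing R] (q : ℍ[R]) :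
    ⇑((stdBasis R).repr q) = ![q.re, q.imI, q.imJ, q.imK] := rfl

end Quaternion

namespace SlicePoly

variable {n : ℕ}

open Quaternion

/-- The polynomials with real coefficients. -/
def ofReal : MvPolynomial (Fin n) ℝ →+* SlicePoly n :=
  AddMonoidAlgebra.mapRingHom _ (algebraMap ℝ ℍ[ℝ])

/-- The constant polynomials. -/
def const : ℍ[ℝ] →+* SlicePoly n := AddMonoidAlgebra.singleZeroRingHom

/-- The values of the monomials at a point of `ℂⁿ`. -/
def monomialValue (z : Fin n → ℂ) : Multiplicative (Fin n →₀ ℕ) →* ℍ[ℂ] where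
  toFun l := ((∏ i, z i ^ l.toAdd i : ℂ) : ℍ[ℂ])
  map_one' := by simp
  map_mul' l m := by
    rw [← Quaternion.coe_mul, ← Finset.prod_mul_distrib]
    simp only [toAdd_mul, Finsupp.add_apply, pow_add]

theorem commute_monomialValue (z : Fin n → ℂ) (q : ℍ[ℝ]) (l : Multiplicative (Fin n →₀ ℕ)) :
    Commute (complexify q) (monomialValue z l) :=
  (Quaternion.coe_commute _ _).symm

/-- Evaluation at a point of `ℂⁿ`, with values in the complexified quaternions. -/
def complexEval (z : Fin n → ℂ) : SlicePoly n →+* ℍ[ℂ] :=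
  AddMonoidAlgebra.liftNCRingHom complexify (monomialValue z) (commute_monomialValue z)

/-- The point of `ℂ_K ⁿ` with coordinates `x + y K`, for `x + y √-1` the coordinates of `z`. -/
def slicePoint (K : ℍ[ℝ]) (z : Fin n → ℂ) : Fin n → ℍ[ℝ] :=
  fun i => ((z i).re : ℍ[ℝ]) + ((z i).im : ℍ[ℝ]) * K

/-- The real polynomial formed by the `m`-th components of the coefficients. -/
def component (m : Fin 4) : SlicePoly n →+ MvPolynomial (Fin n) ℝ where
  toFun := AddMonoidAlgebra.map ((stdBasis ℝ).coord m : ℍ[ℝ] →+ ℝ)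
  map_zero' := AddMonoidAlgebra.map_zero _
  map_add' := AddMonoidAlgebra.map_add _

theorem component_single (m : Fin 4) (l : Fin n →₀ ℕ) (q : ℍ[ℝ]) :
    component m (AddMonoidAlgebra.single l q) =
      AddMonoidAlgebra.single l ((stdBasis ℝ).repr q m) :=
  AddMonoidAlgebra.map_single _ _ _

theorem ofReal_single (l : Fin n →₀ ℕ) (r : ℝ) :
    ofReal (AddMonoidAlgebra.single l r) = AddMonoidAlgebra.single l (r : ℍ[ℝ]) :=
  AddMonoidAlgebra.mapRingHom_single _ _ _

theorem complexEval_single (z : Fin n → ℂ) (l : Fin n →₀ ℕ) (q : ℍ[ℝ]) :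
    complexEval z (AddMonoidAlgebra.single l q) =
      ((∏ i, z i ^ l i : ℂ) : ℍ[ℂ]) * complexify q := by
  rw [complexEval, AddMonoidAlgebra.liftNCRingHom_single, Quaternion.coe_commutes]
  rfl

theorem aeval_single (z : Fin n → ℂ) (l : Fin n →₀ ℕ) (r : ℝ) :
    MvPolynomial.aeval z (AddMonoidAlgebra.single l r : MvPolynomial (Fin n) ℝ) =
      (∏ i, z i ^ l i) * r := by
  refine (MvPolynomial.aeval_monomial z l r).trans ?_
  rw [mul_comm, Finsupp.prod_fintype _ _ fun _ => pow_zero _]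
  rfl

theorem complexEval_const (z : Fin n → ℂ) (q : ℍ[ℝ]) :
    complexEval z (const q) = complexify q := by
  refine (complexEval_single z 0 q).trans ?_
  simp

theorem complexEval_ofReal (z : Fin n → ℂ) (f : MvPolynomial (Fin n) ℝ) :
    complexEval z (ofReal f) = ((MvPolynomial.aeval z f : ℂ) : ℍ[ℂ]) := by
  induction f using AddMonoidAlgebra.induction_linear with
  | zero => simp
  | add f g hf hg => simp only [map_add, hf, hg, Quaternion.coe_add]
  | single l r =>
    have hr : complexify (r : ℍ[ℝ]) = ((r : ℂ) : ℍ[ℂ]) := by ext <;> simp [complexify_apply]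
    rw [ofReal_single, complexEval_single, aeval_single, hr, ← Quaternion.coe_mul]

theorem commute_ofReal (f : MvPolynomial (Fin n) ℝ) (P : SlicePoly n) :
    Commute (ofReal f) P := by
  induction f using AddMonoidAlgebra.induction_linear with
  | zero => simp
  | add f g hf hg => rw [map_add]; exact hf.add_left hg
  | single l r =>
    induction P using AddMonoidAlgebra.induction_linear with
    | zero => simp
    | add f g hf hg => exact hf.add_right hg
    | single m q =>
      rw [Commute, SemiconjBy, ofReal_single, AddMonoidAlgebra.single_mul_single,
        AddMonoidAlgebra.single_mul_single, add_comm, Quaternion.coe_commutes]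

theorem eq_sum_component (P : SlicePoly n) :
    P = ∑ m, ofReal (component m P) * const (stdBasis ℝ m) := by
  induction P using AddMonoidAlgebra.induction_linear with
  | zero => simp
  | add f g hf hg =>
    simp only [map_add, add_mul, Finset.sum_add_distrib]
    rw [← hf, ← hg]
  | single l q =>
    have h (m : Fin 4) : ofReal (component m (AddMonoidAlgebra.single l q)) *
        const (n := n) (stdBasis ℝ m) =
        AddMonoidAlgebra.single l ((stdBasis ℝ).repr q m • stdBasis ℝ m) := by
      rw [component_single, ofReal_single]
      refine (AddMonoidAlgebra.single_mul_single _ _ _ _).trans ?_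
      rw [add_zero, Quaternion.coe_mul_eq_smul]
    simp only [h]
    conv_lhs => rw [← (stdBasis ℝ).sum_repr q]
    exact map_sum (AddMonoidAlgebra.singleAddHom l) _ _

theorem repr_complexEval (z : Fin n → ℂ) (P : SlicePoly n) (m : Fin 4) :
    (stdBasis ℂ).repr (complexEval z P) m = MvPolynomial.aeval z (component m P) := by
  induction P using AddMonoidAlgebra.induction_linear with
  | zero => simp
  | add f g hf hg => simp only [map_add, Finsupp.add_apply, hf, hg]
  | single l q =>
    rw [complexEval_single, component_single, aeval_single, stdBasis_repr, stdBasis_repr]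
    fin_cases m <;> simp [complexify_apply, Quaternion.coe_mul_eq_smul]

theorem complexEval_eq_zero_iff {z : Fin n → ℂ} {P : SlicePoly n} :
    complexEval z P = 0 ↔ ∀ m, MvPolynomial.aeval z (component m P) = 0 := by
  rw [← (stdBasis ℂ).repr.map_eq_zero_iff, Finsupp.ext_iff]
  simp only [repr_complexEval, Finsupp.zero_apply]

theorem regConj_zero : regConj (0 : SlicePoly n) = 0 :=
  AddMonoidAlgebra.map_zero (starAddEquiv : ℍ[ℝ] ≃+ ℍ[ℝ]).toAddMonoidHom

theorem regConj_add (P Q : SlicePoly n) : regConj (P + Q) = regConj P + regConj Q :=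
  AddMonoidAlgebra.map_add (starAddEquiv : ℍ[ℝ] ≃+ ℍ[ℝ]).toAddMonoidHom P Q

theorem regConj_single (l : Fin n →₀ ℕ) (q : ℍ[ℝ]) :
    regConj (AddMonoidAlgebra.single l q) = AddMonoidAlgebra.single l (star q) :=
  AddMonoidAlgebra.map_single (starAddEquiv : ℍ[ℝ] ≃+ ℍ[ℝ]).toAddMonoidHom q l

theorem complexEval_regConj (z : Fin n → ℂ) (P : SlicePoly n) :
    complexEval z (regConj P) = star (complexEval z P) := by
  induction P using AddMonoidAlgebra.induction_linear with
  | zero => rw [regConj_zero, map_zero, star_zero]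
  | add f g hf hg => 
    rw [regConj_add, map_add, map_add, hf, hg]
    ext <;> simp <;> ring
  | single l q =>
    have h : complexify (star q) = star (complexify q) := by ext <;> simp [complexify_apply]
    rw [regConj_single, complexEval_single, complexEval_single, star_mul, Quaternion.star_coe, h,
      Quaternion.coe_commutes]

theorem complexEval_symmetrization (z : Fin n → ℂ) (P : SlicePoly n) :
    complexEval z (symmetrization P) = ((normSq (complexEval z P) : ℂ) : ℍ[ℂ]) := by
  rw [symmetrization, map_mul, complexEval_regConj, Quaternion.self_mul_star]

theorem eval_add (a : Fin n → ℍ[ℝ]) (P Q : SlicePoly n) :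
    eval a (P + Q) = eval a P + eval a Q :=
  Finsupp.sum_add_index' (fun _ => mul_zero _) fun _ _ _ => mul_add _ _ _

theorem eval_single (a : Fin n → ℍ[ℝ]) (l : Fin n →₀ ℕ) (q : ℍ[ℝ]) :
    eval a (AddMonoidAlgebra.single l q) = (List.ofFn fun i => a i ^ l i).prod * q :=
  Finsupp.sum_single_index (mul_zero _)

/-- The powers in a monomial all lie in the commutative field `ℂ_K`, so their product is the image
of the complex monomial. -/
theorem eval_slicePoint {K : ℍ[ℝ]} (hK : K * K = -1) (z : Fin n → ℂ) (P : SlicePoly n) :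
    eval (slicePoint K z) P = specialize K (complexEval z P) := by
  induction P using AddMonoidAlgebra.induction_linear with
  | zero => simp [eval]
  | add f g hf hg => rw [eval_add, map_add, map_add, hf, hg]
  | single l q =>
    have h (i : Fin n) : slicePoint K z i = Complex.lift ⟨K, hK⟩ (z i) := by
      simp [slicePoint, Quaternion.coe_mul_eq_smul]
    rw [eval_single, complexEval_single, specialize_coe_mul hK, specialize_complexify,
      ← List.prod_ofFn, map_list_prod, List.map_ofFn]
    simp only [h, Function.comp_def, map_pow]

end SlicePoly

/-! ### Linear functionals on finite torsion-free modules -/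

/-- Over a domain, a finite torsion-free module is torsionless. -/
theorem Module.exists_dual_apply_ne_zero_of_isTorsionFree {B M : Type*} [CommRing B] [IsDomain B]
    [AddCommGroup M] [Module B M] [Module.Finite B M]
    (htf : ∀ (b : B) (m : M), b • m = 0 → b = 0 ∨ m = 0) {x : M} (hx : x ≠ 0) :
    ∃ φ : M →ₗ[B] B, φ x ≠ 0 := by
  let S := nonZeroDivisors B
  let F := FractionRing B
  let ι := LocalizedModule.mkLinearMap S M
  have hιx : ι x ≠ 0 := fun h => by
    obtain ⟨c, hc⟩ := (IsLocalizedModule.eq_zero_iff S ι).1 h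
    exact (htf _ _ hc).elim (nonZeroDivisors.coe_ne_zero c) hx
  obtain ⟨ψ, hψ⟩ : ∃ ψ : Module.Dual F (LocalizedModule S M), ψ (ι x) ≠ 0 := by
    by_contra! h
    exact hιx ((Module.forall_dual_apply_eq_zero_iff F _).1 h)
  let χ : M →ₗ[B] F := (ψ.restrictScalars B).comp ι
  obtain ⟨s, hs⟩ := Module.Finite.fg_top (R := B) (M := M)
  -- Clearing denominators on a finite generating set makes the functional take values in `B`.
  obtain ⟨b, hb⟩ := IsLocalization.exist_integer_multiples S s χ
  have hrange (m : M) : ((b : B) • χ) m ∈ LinearMap.range (Algebra.linearMap B F) := by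
    have : Submodule.span B (s : Set M) ≤
        (LinearMap.range (Algebra.linearMap B F)).comap ((b : B) • χ) :=
      Submodule.span_le.2 fun a ha => hb a ha
    exact this (hs ▸ Submodule.mem_top)
  let e := LinearEquiv.ofInjective (Algebra.linearMap B F) (IsFractionRing.injective B F)
  refine ⟨e.symm.toLinearMap.comp (((b : B) • χ).codRestrict _ hrange), fun h => ?_⟩
  have h0 := congrArg Subtype.val (e.symm.map_eq_zero_iff.1 h)
  have h1 : (b : B) • ψ (ι x) = 0 := h0
  rw [Algebra.smul_def, mul_eq_zero] at h1
  refine h1.elim (fun h => ?_) hψ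
  exact nonZeroDivisors.coe_ne_zero b ((FaithfulSMul.algebraMap_eq_zero_iff B F).1 h)

/-- A finite module on which the elements outside a prime ideal `p` act injectively and those of `p`
by zero has enough linear maps to the quotient by `p`. -/
theorem Module.exists_linearMap_quotient_apply_ne_zero {R M : Type*} [CommRing R]
    [AddCommGroup M] [Module R M] [Module.Finite R M] (p : Ideal R) [p.IsPrime]
    (hp : Module.IsTorsionBySet R M p)
    (htf : ∀ (r : R) (m : M), r • m = 0 → r ∈ p ∨ m = 0) {x : M} (hx : x ≠ 0) :
    ∃ φ : M →ₗ[R] R ⧸ p, φ x ≠ 0 := by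
  let _ := hp.module
  have : IsScalarTower R (R ⧸ p) M := hp.isScalarTower
  have : Module.Finite (R ⧸ p) M := Module.Finite.of_restrictScalars_finite R _ _
  obtain ⟨φ, hφ⟩ := Module.exists_dual_apply_ne_zero_of_isTorsionFree (B := R ⧸ p) (M := M)
    (fun b m h => by
      obtain ⟨r, rfl⟩ := Ideal.Quotient.mk_surjective b
      rw [Ideal.Quotient.eq_zero_iff_mem]
      exact htf r m h) hx
  exact ⟨φ.restrictScalars R, hφ⟩

/-! ### Imaginary units and kernels of specializations -/

namespace Quaternion

theorem exists_mul_self_eq_neg_one_ne (K K' : ℍ[ℝ]) :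
    ∃ L : ℍ[ℝ], L * L = -1 ∧ L ≠ K ∧ L ≠ K' := by
  obtain ⟨a, a1, a2, a3, a4⟩ :
      ∃ K : ℍ[ℝ], K.re = 0 ∧ K.imI = 1 ∧ K.imJ = 0 ∧ K.imK = 0 := ⟨⟨0, 1, 0, 0⟩, rfl, rfl, rfl, rfl⟩
  obtain ⟨b, b1, b2, b3, b4⟩ :
      ∃ K : ℍ[ℝ], K.re = 0 ∧ K.imI = 0 ∧ K.imJ = 1 ∧ K.imK = 0 := ⟨⟨0, 0, 1, 0⟩, rfl, rfl, rfl, rfl⟩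
  obtain ⟨c, c1, c2, c3, c4⟩ :
      ∃ K : ℍ[ℝ], K.re = 0 ∧ K.imI = 0 ∧ K.imJ = 0 ∧ K.imK = 1 := ⟨⟨0, 0, 0, 1⟩, rfl, rfl, rfl, rfl⟩
  have ha : a * a = -1 := by ext <;> simp [a1, a2, a3, a4]
  have hb : b * b = -1 := by ext <;> simp [b1, b2, b3, b4]
  have hc : c * c = -1 := by ext <;> simp [c1, c2, c3, c4]
  have hab : a ≠ b := fun h => by simp [h, b2] at a2
  have hac : a ≠ c := fun h => by simp [h, c2] at a2
  have hbc : b ≠ c := fun h => by simp [h, c3] at b3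
  by_contra! h
  grind

/-- Writing `w' = a + √-1 b` with real quaternions `a`, `b`, the central `√-1` moves to the left,
where it acts as `K`, and `a`, `b` factor out on the right. -/
theorem specialize_mul_eq_zero {K : ℍ[ℝ]} (hK : K * K = -1) {w : ℍ[ℂ]} (hw : specialize K w = 0)
    (w' : ℍ[ℂ]) : specialize K (w * w') = 0 := by
  have h : w' = complexify (realPart w') + ((Complex.I : ℂ) : ℍ[ℂ]) * complexify (imagPart w') := by
    apply complexified_ext <;> ext <;> simp [complexify_apply]
  rw [h, mul_add, ← mul_assoc, ← Quaternion.coe_commutes, mul_assoc, map_add,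
    specialize_coe_mul hK, specialize_mul_complexify, specialize_mul_complexify, hw]
  simp

theorem specialize_coe {K : ℍ[ℝ]} (hK : K * K = -1) (t : ℂ) :
    specialize K (t : ℍ[ℂ]) = Complex.lift ⟨K, hK⟩ t := by
  have h := specialize_coe_mul hK t (complexify 1)
  rwa [map_one, mul_one, ← map_one complexify, specialize_complexify, mul_one] at h

theorem specialize_coe_eq_zero {K : ℍ[ℝ]} (hK : K * K = -1) {t : ℂ} :
    specialize K (t : ℍ[ℂ]) = 0 ↔ t = 0 := by
  rw [specialize_coe hK, map_eq_zero]

theorem normSq_eq_zero_of_specialize {K : ℍ[ℝ]} (hK : K * K = -1) {w : ℍ[ℂ]}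
    (hw : specialize K w = 0) : normSq w = 0 := by
  rw [← specialize_coe_eq_zero hK, ← Quaternion.self_mul_star]
  exact specialize_mul_eq_zero hK hw _

end Quaternion

/-! ### Right ideals of points and their zero loci -/

namespace SliceRightIdeal

open Quaternion SlicePoly

variable {n : ℕ}

theorem mul_mem_right {I : SliceRightIdeal n} {P : SlicePoly n} (hP : P ∈ I) (Q : SlicePoly n) :
    P * Q ∈ I :=
  I.smul_mem (MulOpposite.op Q) hP

/-- The polynomials vanishing at the point of `ℂ_K ⁿ` that corresponds to `z`. -/
def ofPoint {K : ℍ[ℝ]} (hK : K * K = -1) (z : Fin n → ℂ) : SliceRightIdeal n where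
  carrier := {P | specialize K (complexEval z P) = 0}
  zero_mem' := by simp
  add_mem' {P Q} hP hQ := by
    change specialize K (complexEval z (P + Q)) = 0
    rw [map_add, map_add, hP, hQ, add_zero]
  smul_mem' Q P hP := by
    change specialize K (complexEval z (Q • P)) = 0
    rw [← MulOpposite.op_unop Q, op_smul_eq_mul, map_mul]
    exact specialize_mul_eq_zero hK hP _

theorem mem_ofPoint {K : ℍ[ℝ]} {hK : K * K = -1} {z : Fin n → ℂ} {P : SlicePoly n} :
    P ∈ ofPoint hK z ↔ specialize K (complexEval z P) = 0 := Iff.rfl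

theorem slicePoint_mem_sliceZeroLocus {I : SliceRightIdeal n} {K : ℍ[ℝ]} (hK : K * K = -1)
    (z : Fin n → ℂ) : slicePoint K z ∈ I.sliceZeroLocus ↔ I ≤ ofPoint hK z := by
  have h : slicePoint K z ∈ I.zeroLocus ↔ I ≤ ofPoint hK z :=
    forall₂_congr fun P _ => by rw [eval_slicePoint hK]; rfl
  rw [← h]
  exact ⟨fun h => h.1, fun h => ⟨h, K, hK, fun i => ⟨_, _, rfl⟩⟩⟩

theorem exists_eq_slicePoint {I : SliceRightIdeal n} {a : Fin n → ℍ[ℝ]}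
    (ha : a ∈ I.sliceZeroLocus) : ∃ K z, K * K = -1 ∧ a = slicePoint K z := by
  obtain ⟨-, K, hK, h⟩ := ha
  choose x y hxy using h
  exact ⟨K, fun i => ⟨x i, y i⟩, hK, funext hxy⟩

theorem sliceZeroLocus_subset_iff {I J : SliceRightIdeal n} :
    I.sliceZeroLocus ⊆ J.sliceZeroLocus ↔
      ∀ K (hK : K * K = -1) (z : Fin n → ℂ), I ≤ ofPoint hK z → J ≤ ofPoint hK z := by
  refine ⟨fun h K hK z hz => ?_, fun h a ha => ?_⟩
  · rw [← slicePoint_mem_sliceZeroLocus] at hz ⊢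
    exact h hz
  · obtain ⟨K, z, hK, rfl⟩ := exists_eq_slicePoint ha
    rw [slicePoint_mem_sliceZeroLocus hK] at ha ⊢
    exact h K hK z ha

theorem le_ofPoint_of_ne {I : SliceRightIdeal n} {K K' L : ℍ[ℝ]} {hK : K * K = -1}
    {hK' : K' * K' = -1} {z : Fin n → ℂ} (hne : K ≠ K') (h : I ≤ ofPoint hK z)
    (h' : I ≤ ofPoint hK' z) (hL : L * L = -1) : I ≤ ofPoint hL z := fun P hP => by
  rw [mem_ofPoint, eq_zero_of_specialize_eq_zero hne (h hP) (h' hP), map_zero]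

theorem exists_le_ofPoint_of_normSq {I : SliceRightIdeal n} {z : Fin n → ℂ}
    (h : ∀ P ∈ I, normSq (complexEval z P) = 0) :
    ∃ (K : ℍ[ℝ]) (hK : K * K = -1), I ≤ ofPoint hK z := by
  obtain ⟨K, hK, hW⟩ := exists_specialize_eq_zero_of_normSq (W := complexEval z '' I)
    (by
      rintro _ ⟨P, hP, rfl⟩ _ ⟨Q, hQ, rfl⟩
      exact ⟨P - Q, I.sub_mem hP hQ, map_sub _ _ _⟩)
    (by
      rintro _ ⟨P, hP, rfl⟩ q
      exact ⟨P * const q, mul_mem_right hP _, by rw [map_mul, complexEval_const]⟩)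
    (by
      rintro _ ⟨P, hP, rfl⟩
      exact h P hP)
  exact ⟨K, hK, fun P hP => hW _ ⟨P, hP, rfl⟩⟩

theorem symmetrization_mem_ofPoint {K : ℍ[ℝ]} {hK : K * K = -1} {z : Fin n → ℂ}
    {P : SlicePoly n} : P.symmetrization ∈ ofPoint hK z ↔ normSq (complexEval z P) = 0 := by
  rw [mem_ofPoint, complexEval_symmetrization, specialize_coe_eq_zero hK]

/-- A right ideal containing a polynomial of nonzero norm at `z` takes all values at `z`. -/
theorem exists_complexEval_eq {I : SliceRightIdeal n} {z : Fin n → ℂ} {R : SlicePoly n}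
    (hR : R ∈ I) (hN : normSq (complexEval z R) ≠ 0) (P : SlicePoly n) :
    ∃ Q ∈ I, complexEval z Q = complexEval z P := by
  set N := normSq (complexEval z R) with hNdef
  have hreal (r : ℝ) : complexify (r : ℍ[ℝ]) = ((r : ℂ) : ℍ[ℂ]) := by
    ext <;> simp [complexify_apply]
  -- The value of `T` at `z` is `2 Re N - N`, the conjugate of `N`; with `c` it inverts `N` without
  -- using complex coefficients.
  let T : SlicePoly n := const ((2 * N.re : ℝ) : ℍ[ℝ]) - R.symmetrization
  let c : SlicePoly n := const (((Complex.normSq N)⁻¹ : ℝ) : ℍ[ℝ])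
  refine ⟨R * (R.regConj * T * c * P), mul_mem_right hR _, ?_⟩
  have h1 : R * (R.regConj * T * c * P) = R.symmetrization * T * c * P := by
    simp only [symmetrization, mul_assoc]
  have hone : N * ((2 * N.re : ℝ) - N) * ((Complex.normSq N)⁻¹ : ℝ) = 1 := by
    have h2 : ((2 * N.re : ℝ) : ℂ) - N = (starRingEnd ℂ) N := by
      apply Complex.ext <;> simp; ring
    rw [h2, Complex.mul_conj, ← Complex.ofReal_mul, mul_inv_cancel₀, Complex.ofReal_one]
    simpa using hN
  rw [h1, map_mul, map_mul, map_mul, map_sub, complexEval_symmetrization, complexEval_const,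
    complexEval_const, hreal, hreal, ← Quaternion.coe_sub, ← Quaternion.coe_mul,
    ← Quaternion.coe_mul, hone, Quaternion.coe_one, one_mul]

end SliceRightIdeal

/-! ### The Nullstellensatz over the real polynomials -/

namespace SlicePoly

variable {n : ℕ}

/-- The slice regular polynomials as a module over the polynomials with real coefficients. -/
instance realModule (n : ℕ) : Module (MvPolynomial (Fin n) ℝ) (SlicePoly n) :=
  Module.compHom _ ofReal

theorem real_smul_def (f : MvPolynomial (Fin n) ℝ) (P : SlicePoly n) : f • P = ofReal f * P := rfl

theorem finite_realModule : Module.Finite (MvPolynomial (Fin n) ℝ) (SlicePoly n) := by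
  have hfg := Submodule.fg_span (R := MvPolynomial (Fin n) ℝ)
    (Set.finite_range fun m => const (n := n) (Quaternion.stdBasis ℝ m))
  suffices h : Submodule.span (MvPolynomial (Fin n) ℝ)
      (Set.range fun m => const (n := n) (Quaternion.stdBasis ℝ m)) = ⊤ from ⟨h ▸ hfg⟩
  refine eq_top_iff.2 fun P _ => ?_
  rw [eq_sum_component P]
  exact Submodule.sum_mem _ fun m _ => Submodule.smul_mem _ (component m P)
    (Submodule.subset_span ⟨m, rfl⟩)

end SlicePoly

namespace SliceRightIdeal

open Quaternion SlicePoly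

variable {n : ℕ}

theorem ofReal_mul_mem {J : SliceRightIdeal n} {P : SlicePoly n} (hP : P ∈ J)
    (f : MvPolynomial (Fin n) ℝ) : ofReal f * P ∈ J :=
  (commute_ofReal f P).eq ▸ mul_mem_right hP _

/-- A right ideal as a submodule over the polynomials with real coefficients. -/
def toRealSubmodule (J : SliceRightIdeal n) :
    Submodule (MvPolynomial (Fin n) ℝ) (SlicePoly n) where
  carrier := J
  zero_mem' := J.zero_mem
  add_mem' := J.add_mem
  smul_mem' f _ hP := ofReal_mul_mem hP f

/-- The ideal of the polynomials with real coefficients in a right ideal. -/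
def realIdeal (J : SliceRightIdeal n) : Ideal (MvPolynomial (Fin n) ℝ) where
  carrier := {f | ofReal f ∈ J}
  zero_mem' := by
    change ofReal 0 ∈ J
    rw [map_zero]
    exact J.zero_mem
  add_mem' {f g} hf hg := by
    change ofReal (f + g) ∈ J
    rw [map_add]
    exact J.add_mem hf hg
  smul_mem' f g hg := by
    change ofReal (f * g) ∈ J
    rw [map_mul]
    exact ofReal_mul_mem hg f

theorem mem_realIdeal {J : SliceRightIdeal n} {f : MvPolynomial (Fin n) ℝ} :
    f ∈ J.realIdeal ↔ ofReal f ∈ J := Iff.rfl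

/-- Centrality of real polynomials gives the stability condition `f * J ⊆ J` for free. -/
theorem IsCompletelyPrime.mem_or_mem_of_ofReal_mul_mem {J : SliceRightIdeal n}
    (hJ : J.IsCompletelyPrime) {f : MvPolynomial (Fin n) ℝ} {P : SlicePoly n}
    (h : ofReal f * P ∈ J) : ofReal f ∈ J ∨ P ∈ J :=
  hJ _ _ h fun _ hR => ofReal_mul_mem hR f

theorem mem_of_one_mem {J : SliceRightIdeal n} (h : (1 : SlicePoly n) ∈ J) (P : SlicePoly n) :
    P ∈ J := by
  simpa using mul_mem_right h P

/-- A polynomial outside a completely prime right ideal is separated from it by its value at some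
point of `ℂⁿ`. -/
theorem IsCompletelyPrime.exists_complexEval_ne {J : SliceRightIdeal n}
    (hJ : J.IsCompletelyPrime) {P : SlicePoly n} (hP : P ∉ J) :
    ∃ z, ∀ R ∈ J, complexEval z R ≠ complexEval z P := by
  have hp : J.realIdeal.IsPrime := by
    refine ⟨fun h => hP (mem_of_one_mem ?_ P), fun {f g} h => ?_⟩
    · rw [← map_one ofReal, ← mem_realIdeal, h]
      trivial
    · rw [mem_realIdeal, map_mul] at h
      exact hJ.mem_or_mem_of_ofReal_mul_mem h
  have := finite_realModule (n := n)
  let π := J.toRealSubmodule.mkQ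
  have hπ {Q : SlicePoly n} : π Q = 0 ↔ Q ∈ J := Submodule.Quotient.mk_eq_zero _
  obtain ⟨φ, hφ⟩ := Module.exists_linearMap_quotient_apply_ne_zero
    (M := SlicePoly n ⧸ J.toRealSubmodule) J.realIdeal
    (by
      rintro m ⟨f, hf⟩
      obtain ⟨Q, rfl⟩ := Submodule.mkQ_surjective _ m
      exact hπ.2 (mul_mem_right hf Q))
    (by
      intro f m h
      obtain ⟨Q, rfl⟩ := Submodule.mkQ_surjective _ m
      exact (hJ.mem_or_mem_of_ofReal_mul_mem (hπ.1 h)).imp_right hπ.2)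
    (x := π P) (fun h => hP (hπ.1 h))
  obtain ⟨b, hb⟩ := Ideal.Quotient.mk_surjective (φ (π P))
  have hbJ : b ∉ J.realIdeal := fun h => hφ (by rw [← hb, Ideal.Quotient.eq_zero_iff_mem.2 h])
  -- The prime ideal consists of all real polynomials vanishing on its complex zeros, so some zero
  -- `z` has `b(z) ≠ 0`.
  rw [← MvPolynomial.IsPrime.vanishingIdeal_zeroLocus (K := ℂ) J.realIdeal,
    MvPolynomial.mem_vanishingIdeal_iff] at hbJ
  push Not at hbJ
  obtain ⟨z, hz, hbz⟩ := hbJ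
  refine ⟨z, fun R hR h => hbz ?_⟩
  let χ : MvPolynomial (Fin n) ℝ ⧸ J.realIdeal →+* ℂ :=
    Ideal.Quotient.lift J.realIdeal (MvPolynomial.aeval z : MvPolynomial (Fin n) ℝ →ₐ[ℝ] ℂ) hz
  have hχ (f) : χ (Ideal.Quotient.mk _ f) = MvPolynomial.aeval z f := rfl
  have hD : complexEval z (P - R) = 0 := by rw [map_sub, h, sub_self]
  rw [complexEval_eq_zero_iff] at hD
  -- If `R` had the value of `P` at `z`, all components of `P - R` would vanish there. They are the
  -- coefficients in the linear expansion of `φ (π P)` over the constant basis, so `b(z)` would be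
  -- zero.
  have hmk : φ (π P) = φ (π (P - R)) := by rw [map_sub, hπ.2 hR, sub_zero]
  rw [← hχ, hb, hmk, eq_sum_component (P - R), map_sum, map_sum, map_sum]
  refine Finset.sum_eq_zero fun m _ => ?_
  obtain ⟨g, hg⟩ := Ideal.Quotient.mk_surjective (φ (π (const (stdBasis ℝ m))))
  rw [← real_smul_def, map_smul, map_smul, ← hg]
  change MvPolynomial.aeval z (component m (P - R) * g) = 0
  rw [map_mul, hD m, zero_mul]

/-- The Nullstellensatz for completely prime right ideals. -/
theorem IsCompletelyPrime.exists_le_ofPoint {J : SliceRightIdeal n}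
    (hJ : J.IsCompletelyPrime) {P : SlicePoly n} (hP : P ∉ J) :
    ∃ (K : ℍ[ℝ]) (hK : K * K = -1) (z : Fin n → ℂ), J ≤ ofPoint hK z ∧ P ∉ ofPoint hK z := by
  obtain ⟨z, hz⟩ := hJ.exists_complexEval_ne hP
  have hN : ∀ R ∈ J, normSq (complexEval z R) = 0 := fun R hR => by
    by_contra hne
    obtain ⟨Q, hQ, h⟩ := exists_complexEval_eq hR hne P
    exact hz Q hQ h
  obtain ⟨K, hK, hle⟩ := exists_le_ofPoint_of_normSq hN
  by_cases hPK : P ∈ ofPoint hK z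
  -- A nonzero value of `J` would span the kernel of the specialization and so reach the value of
  -- `P`. Hence `J` vanishes on the whole sphere while `P` does not, and any other unit separates
  -- them.
  · have hzero : ∀ R ∈ J, complexEval z R = 0 := fun R hR => by
      by_contra hne
      obtain ⟨q, hq⟩ := exists_eq_mul_complexify hne (hle hR) hPK
      refine hz (R * const q) (mul_mem_right hR _) ?_
      rw [hq, map_mul, complexEval_const]
    obtain ⟨L, hL, hLK, -⟩ := exists_mul_self_eq_neg_one_ne K K
    refine ⟨L, hL, z, fun R hR => ?_, fun hPL => ?_⟩
    · rw [mem_ofPoint, hzero R hR, map_zero]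
    · refine hz 0 J.zero_mem ?_
      rw [map_zero, eq_zero_of_specialize_eq_zero hLK hPL hPK]
  · exact ⟨K, hK, z, hle, hPK⟩

/-- The Nullstellensatz: a radical right ideal contains the polynomials vanishing on its zeros. -/
theorem IsRadical.mem_of_forall_ofPoint {I : SliceRightIdeal n} (hI : I.IsRadical)
    {P : SlicePoly n}
    (h : ∀ (K : ℍ[ℝ]) (hK : K * K = -1) (z : Fin n → ℂ), I ≤ ofPoint hK z → P ∈ ofPoint hK z) :
    P ∈ I := by
  rw [← hI, radical, Submodule.mem_sInf]
  rintro J ⟨hIJ, hJ⟩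
  by_contra hP
  obtain ⟨K, hK, z, hle, hPz⟩ := hJ.exists_le_ofPoint hP
  exact hPz (h K hK z (hIJ.trans hle))

/-! ### Quasi primality and irreducibility -/

theorem one_notMem_ofPoint {K : ℍ[ℝ]} {hK : K * K = -1} {z : Fin n → ℂ} :
    (1 : SlicePoly n) ∉ ofPoint hK z := by
  rw [mem_ofPoint, map_one, ← map_one complexify, specialize_complexify]
  exact one_ne_zero

theorem ne_top_of_not_sliceZeroLocus_subset {I J : SliceRightIdeal n}
    (h : ¬ I.sliceZeroLocus ⊆ J.sliceZeroLocus) : I ≠ ⊤ := by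
  rintro rfl
  exact h (sliceZeroLocus_subset_iff.2 fun K hK z hle =>
    (one_notMem_ofPoint (hle Submodule.mem_top)).elim)

theorem sliceZeroLocus_eq_union_iff {I I₁ I₂ : SliceRightIdeal n} :
    I.sliceZeroLocus = I₁.sliceZeroLocus ∪ I₂.sliceZeroLocus ↔
      ∀ K (hK : K * K = -1) (z : Fin n → ℂ),
        I ≤ ofPoint hK z ↔ I₁ ≤ ofPoint hK z ∨ I₂ ≤ ofPoint hK z := by
  refine ⟨fun h K hK z => ?_, fun h => Set.ext fun a => ⟨fun ha => ?_, fun ha => ?_⟩⟩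
  · simp only [← slicePoint_mem_sliceZeroLocus, h, Set.mem_union]
  · obtain ⟨K, z, hK, rfl⟩ := exists_eq_slicePoint ha
    simpa only [← slicePoint_mem_sliceZeroLocus, ← Set.mem_union] using
      (h K hK z).1 ((slicePoint_mem_sliceZeroLocus hK z).1 ha)
  · obtain ⟨K, z, hK, rfl⟩ : ∃ K z, K * K = -1 ∧ a = slicePoint K z :=
      ha.elim exists_eq_slicePoint exists_eq_slicePoint
    rw [slicePoint_mem_sliceZeroLocus hK, h]
    exact ha.imp (slicePoint_mem_sliceZeroLocus hK z).1 (slicePoint_mem_sliceZeroLocus hK z).1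

theorem IsRadical.isQuasiPrime_of_isSliceIrreducible {I : SliceRightIdeal n} (hI : I.IsRadical)
    (hirr : IsSliceIrreducible I.sliceZeroLocus) : I.IsQuasiPrime := by
  intro P Q hPQ
  by_contra! ⟨hP, hS⟩
  let J (R : SlicePoly n) : SliceRightIdeal n := I ⊔ Submodule.span _ {R}
  have hJ {R : SlicePoly n} {K : ℍ[ℝ]} {hK : K * K = -1} {z : Fin n → ℂ} :
      J R ≤ ofPoint hK z ↔ I ≤ ofPoint hK z ∧ R ∈ ofPoint hK z := by
    rw [sup_le_iff, Submodule.span_singleton_le_iff_mem]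
  have hJne {R : SlicePoly n} (hR : R ∉ I) : J R ≠ ⊥ := fun h => hR <| by
    have : R ∈ J R := Submodule.mem_sup_right (Submodule.mem_span_singleton_self R)
    rw [h, Submodule.mem_bot] at this
    exact this ▸ I.zero_mem
  have hunion : ∀ K (hK : K * K = -1) (z : Fin n → ℂ), I ≤ ofPoint hK z ↔
      J P ≤ ofPoint hK z ∨ J Q.symmetrization ≤ ofPoint hK z := fun K hK z => by
    rw [hJ, hJ, ← and_or_left, iff_self_and]
    intro hle
    -- `P * Q ^ s = (P * Q) * Q ^ c` lies in `I`, and the scalar value of `Q ^ s` factors out of the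
    -- specialization.
    have h : P * Q.symmetrization ∈ ofPoint hK z := by
      rw [symmetrization, ← mul_assoc]
      exact hle (mul_mem_right hPQ _)
    rw [mem_ofPoint, map_mul, complexEval_symmetrization, ← Quaternion.coe_commutes,
      specialize_coe_mul hK, mul_eq_zero, map_eq_zero] at h
    rw [symmetrization_mem_ofPoint]
    exact h.symm
  have hnot {R T : SlicePoly n} (hT : T ∉ I)
      (hRT : ∀ K (hK : K * K = -1) (z : Fin n → ℂ), I ≤ ofPoint hK z →
        J R ≤ ofPoint hK z ∨ J T ≤ ofPoint hK z) :
      ¬ (J R).sliceZeroLocus ⊆ (J T).sliceZeroLocus := fun h =>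
    hT <| hI.mem_of_forall_ofPoint fun K hK z hle =>
      (hJ.1 ((hRT K hK z hle).elim (sliceZeroLocus_subset_iff.1 h K hK z) id)).2
  have h₁ := hnot hS fun K hK z => (hunion K hK z).1
  have h₂ := hnot hP fun K hK z hle => ((hunion K hK z).1 hle).symm
  exact hirr ⟨J P, J Q.symmetrization, hJne hP, ne_top_of_not_sliceZeroLocus_subset h₁, hJne hS,
    ne_top_of_not_sliceZeroLocus_subset h₂, h₁, h₂, sliceZeroLocus_eq_union_iff.2 hunion⟩

theorem exists_mem_notMem_of_not_le_ofPoint {I J : SliceRightIdeal n} {K : ℍ[ℝ]}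
    {hK : K * K = -1} {z : Fin n → ℂ} (hI : I ≤ ofPoint hK z) (hJ : ¬ J ≤ ofPoint hK z) :
    ∃ P ∈ J, P ∉ I := by
  obtain ⟨P, hP, hne⟩ := SetLike.not_le_iff_exists.1 hJ
  exact ⟨P, hP, fun h => hne (hI h)⟩

/-- If the zeros of a quasi prime radical right ideal `I` are those of `I₁` and `I₂`, and `I₂` is not
contained in `I`, then every sphere meeting the zeros of `I` meets those of `I₁`. -/
theorem IsQuasiPrime.exists_le_ofPoint {I I₁ I₂ : SliceRightIdeal n} (hq : I.IsQuasiPrime)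
    (hI : I.IsRadical)
    (hunion : ∀ K (hK : K * K = -1) (z : Fin n → ℂ),
      I ≤ ofPoint hK z ↔ I₁ ≤ ofPoint hK z ∨ I₂ ≤ ofPoint hK z)
    {Q : SlicePoly n} (hQ : Q ∈ I₂) (hQI : Q ∉ I) {K : ℍ[ℝ]} {hK : K * K = -1} {z : Fin n → ℂ}
    (hz : I ≤ ofPoint hK z) : ∃ (L : ℍ[ℝ]) (hL : L * L = -1), I₁ ≤ ofPoint hL z := by
  refine exists_le_ofPoint_of_normSq fun P hP => ?_
  have hmem : Q * P.symmetrization ∈ I := hI.mem_of_forall_ofPoint fun L hL x hx => by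
    rcases (hunion L hL x).1 hx with h | h
    · rw [mem_ofPoint, map_mul, complexEval_symmetrization,
        normSq_eq_zero_of_specialize hL (h hP), Quaternion.coe_zero, mul_zero, map_zero]
    · exact mul_mem_right (h hQ) _
  have h := hz ((hq _ _ hmem).resolve_left hQI)
  -- Quasi primality gives `(P ^ s) ^ s ∈ I`, whose value is a power of the norm of the value of
  -- `P`.
  rw [symmetrization_mem_ofPoint, complexEval_symmetrization, Quaternion.normSq_coe] at h
  exact pow_eq_zero_iff two_ne_zero |>.1 h

theorem IsQuasiPrime.isSliceIrreducible {I : SliceRightIdeal n} (hq : I.IsQuasiPrime)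
    (hI : I.IsRadical) : IsSliceIrreducible I.sliceZeroLocus := by
  rintro ⟨I₁, I₂, -, -, -, -, h₁₂, h₂₁, hunion⟩
  rw [sliceZeroLocus_eq_union_iff] at hunion
  rw [sliceZeroLocus_subset_iff] at h₁₂ h₂₁
  push Not at h₁₂ h₂₁
  obtain ⟨K₁, hK₁, z₁, hz₁, hz₁'⟩ := h₁₂
  obtain ⟨K₂, hK₂, z₂, hz₂, hz₂'⟩ := h₂₁
  have hle₁ : I ≤ ofPoint hK₁ z₁ := (hunion _ _ _).2 (.inl hz₁)
  obtain ⟨P, hP, hPI⟩ := exists_mem_notMem_of_not_le_ofPoint ((hunion _ _ _).2 (.inr hz₂)) hz₂'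
  obtain ⟨Q, hQ, hQz⟩ := SetLike.not_le_iff_exists.1 hz₁'
  -- A real `f` vanishing wherever the whole sphere consists of zeros of `I₂` makes `P * f` vanish
  -- on all zeros of `I`, so `f ^ s ∈ I`. The components of `Q` are such polynomials, hence `Q`
  -- vanishes at `z₁`.
  have hreal (f : MvPolynomial (Fin n) ℝ)
      (hf : ∀ z, (∀ L (hL : L * L = -1), I₂ ≤ ofPoint hL z) → MvPolynomial.aeval z f = 0) :
      MvPolynomial.aeval z₁ f = 0 := by
    have hmem : P * ofReal f ∈ I := hI.mem_of_forall_ofPoint fun K hK z hz => by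
      by_cases hz' : I₁ ≤ ofPoint hK z
      · exact mul_mem_right (hz' hP) _
      have hI₂ := ((hunion K hK z).1 hz).resolve_left hz'
      suffices h : ∀ L (hL : L * L = -1), I₂ ≤ ofPoint hL z by
        rw [mem_ofPoint, map_mul, complexEval_ofReal, hf z h, Quaternion.coe_zero, mul_zero,
          map_zero]
      obtain ⟨K', hK', hle⟩ := hq.exists_le_ofPoint hI hunion hQ (fun h => hQz (hle₁ h)) hz
      have hne : K ≠ K' := by
        rintro rfl
        exact hz' hle
      -- Zeros of `I` at `K` and `K'` fill the sphere. At a third unit `L`, a zero of `I₁` would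
      -- spread to `K`; so `I₂` vanishes at `L` and at `K`, hence everywhere on the sphere.
      obtain ⟨L, hL, hLK, hLK'⟩ := exists_mul_self_eq_neg_one_ne K K'
      have hall := le_ofPoint_of_ne hne hz ((hunion _ _ _).2 (.inl hle)) hL
      rcases (hunion _ _ _).1 hall with h | h
      · exact (hz' (le_ofPoint_of_ne hLK' h hle hK)).elim
      · exact fun _ hM => le_ofPoint_of_ne hLK h hI₂ hM
    have h := hle₁ ((hq _ _ hmem).resolve_left hPI)
    rw [symmetrization_mem_ofPoint, complexEval_ofReal, Quaternion.normSq_coe] at h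
    exact pow_eq_zero_iff two_ne_zero |>.1 h
  refine hQz ?_
  rw [mem_ofPoint, complexEval_eq_zero_iff.2 fun m => hreal _ fun z hz => ?_, map_zero]
  obtain ⟨L, hL, hLK, -⟩ := exists_mul_self_eq_neg_one_ne K₁ K₁
  exact complexEval_eq_zero_iff.1
    (eq_zero_of_specialize_eq_zero hLK (hz L hL hQ) (hz K₁ hK₁ hQ)) m

end SliceRightIdeal

end

theorem theorem3p2 (n : ℕ) (I : SliceRightIdeal n) (hI : I.IsRadical) :
    I.IsQuasiPrime ↔ IsSliceIrreducible I.sliceZeroLocus :=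
  ⟨fun hq => hq.isSliceIrreducible hI, hI.isQuasiPrime_of_isSliceIrreducible⟩
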